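/- Let $n\ge2$, let $\Omega\subset\mathbb R^n$ be a bounded domain (a non-empty connected open set), and let $\rho$ be a bounded positive continuous function on $\Omega$ such that $\log\frac1\rho$ is convex, in the sense that it is the restriction to $\Omega$ of a convex function on the convex hull of $\Omega$ (if $\Omega$ is convex, this is convexity in the usual sense). For real $\alpha>0$ let $L^2_{\mathrm{harm}}(\Omega,\rho^\alpha)$ be the space of all complex-valued harmonic functions $h$ on $\Omega$ with $\int_\Omega|h(x)|^2\rho(x)^\alpha\,dx<\infty$, where $dx$ is Lebesgue measure. Then this space has a reproducing kernel $R_\alpha$ (the harmonic Bergman kernel): for every $y\in\Omega$ one has $R_\alpha(\cdot,y)\in L^2_{\mathrm{harm}}(\Omega,\rho^\alpha)$ and $$h(y)=\int_\Omega h(x)\,\overline{R_\alpha(x,y)}\,\rho(x)^\alpha\,dx\qquad\text{for all }h\in L^2_{\mathrm{harm}}(\Omega,\rho^\alpha),$$ which determines $R_\alpha$ uniquely on $\Omega\times\Omega$ and makes $R_\alpha(x,x)$ real and non-negative. Moreover, for every $x\in\Omega$, $$\lim_{\alpha\to+\infty}R_\alpha(x,x)^{1/\alpha}=\frac1{\rho(x)}.$$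 -/

import Mathlib

open MeasureTheory Filter Topology

/-- The measure `w(x) dx` on `Ω ⊆ ℝⁿ`, where `dx` is Lebesgue measure and `w` is a weight. -/
noncomputable def weightedMeasure {n : ℕ} (Ω : Set (EuclideanSpace ℝ (Fin n)))
    (w : EuclideanSpace ℝ (Fin n) → ℝ) : Measure (EuclideanSpace ℝ (Fin n)) :=
  (volume.restrict Ω).withDensity (fun x => ENNReal.ofReal (w x))

/-- The weighted harmonic Bergman space `L²_harm(Ω, w)`: complex-valued functions that are harmonic
on the open set `Ω` and square-integrable with respect to `w(x) dx`. Functions on `Ω` are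
represented by functions on `ℝⁿ` whose values off `Ω` are irrelevant. -/
def harmonicBergmanSpace {n : ℕ} (Ω : Set (EuclideanSpace ℝ (Fin n)))
    (w : EuclideanSpace ℝ (Fin n) → ℝ) : Set (EuclideanSpace ℝ (Fin n) → ℂ) :=
  {h | InnerProductSpace.HarmonicOnNhd h Ω ∧ MemLp h 2 (weightedMeasure Ω w)}

/-- `R` is the harmonic Bergman kernel, that is, the reproducing kernel of `L²_harm(Ω, w)`:
for each `y ∈ Ω`, the function `R(·, y)` belongs to the space and represents evaluation at `y`.
This determines `R` on `Ω × Ω`, and forces `R(y, y) = ‖R(·, y)‖² ≥ 0`. -/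
def IsHarmonicBergmanKernel {n : ℕ} (Ω : Set (EuclideanSpace ℝ (Fin n)))
    (w : EuclideanSpace ℝ (Fin n) → ℝ)
    (R : EuclideanSpace ℝ (Fin n) → EuclideanSpace ℝ (Fin n) → ℂ) : Prop :=
  ∀ y ∈ Ω, (fun x => R x y) ∈ harmonicBergmanSpace Ω w ∧
    ∀ h ∈ harmonicBergmanSpace Ω w,
      h y = ∫ x, h x * (starRingEnd ℂ) (R x y) ∂(weightedMeasure Ω w)

/-! On the diagonal, `R_α(x,x)` is the squared norm of evaluation at `x`, that is, the supremum of
`|h(x)|² / ‖h‖²` over nonzero `h` in the space. It is squeezed between two bounds whose `α`-th roots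
tend to `1/ρ(x)`.

Upper bound (`IsHarmonicBergmanKernel.re_self_le`): the mean value property against a smooth radial
density on a small ball, with Cauchy–Schwarz, gives `R_α(x,x) ≤ C c^(-α)` if `ρ ≥ c` on that ball,
where `C` does not depend on `α`. By continuity `c` can be taken as close to `ρ(x)` as desired.

Lower bound (`IsHarmonicBergmanKernel.one_le_mul_re_self`): one test function suffices. A
subgradient `g` of `log(1/ρ)` at `x` gives `ρ(y) exp(g(y - x)) ≤ ρ(x)` on `Ω`. In dimension at least
two, `exp(α g(y - x)/2)` is the modulus of a harmonic `h`. Then `|h(x)| = 1` and `‖h‖² ≤ |Ω|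
ρ(x)^α`, so `R_α(x,x) ≥ 1/(|Ω| ρ(x)^α)`.

Existence is the Riesz argument: the same mean value formula makes evaluation bounded and shows that
harmonicity survives `L²` limits, so the space is complete. -/

/-! ### A smooth radial density and its potential -/

section RadialKernel

variable {E : Type*} [NormedAddCommGroup E]

/-- A smooth radial function supported in the closed unit ball. -/
noncomputable def radialPotential (x : E) : ℝ := expNegInvGlue (1 - ‖x‖ ^ 2)

/-- The radial density `k` with `∇ radialPotential = -k(x) x`. -/
noncomputable def radialKernel (x : E) : ℝ :=
  2 * ((1 - ‖x‖ ^ 2)⁻¹ ^ 2 * expNegInvGlue (1 - ‖x‖ ^ 2))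

theorem expNegInvGlue_one_sub_sq_eq_zero {x : E} (hx : 1 ≤ ‖x‖) :
    expNegInvGlue (1 - ‖x‖ ^ 2) = 0 :=
  expNegInvGlue.zero_of_nonpos (by nlinarith)

theorem radialPotential_eq_zero {x : E} (hx : 1 ≤ ‖x‖) : radialPotential x = 0 :=
  expNegInvGlue_one_sub_sq_eq_zero hx

theorem radialKernel_eq_zero {x : E} (hx : 1 ≤ ‖x‖) : radialKernel x = 0 := by
  simp [radialKernel, expNegInvGlue_one_sub_sq_eq_zero hx]

theorem radialKernel_nonneg (x : E) : 0 ≤ radialKernel x := by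
  have := expNegInvGlue.nonneg (1 - ‖x‖ ^ 2)
  unfold radialKernel
  positivity

theorem radialKernel_zero_ne_zero : radialKernel (0 : E) ≠ 0 := by
  have := expNegInvGlue.pos_of_pos one_pos
  simp [radialKernel, this.ne']

theorem radialKernel_neg (x : E) : radialKernel (-x) = radialKernel x := by
  simp [radialKernel]

variable [InnerProductSpace ℝ E]

theorem contDiff_radialPotential {m : ℕ∞} : ContDiff ℝ m (radialPotential : E → ℝ) :=
  expNegInvGlue.contDiff.comp (contDiff_const.sub (contDiff_norm_sq ℝ))

/-- The flatness of `expNegInvGlue` at zero absorbs the negative power of `1 - ‖x‖ ^ 2`, so nothing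
singular happens on the unit sphere. -/
theorem contDiff_radialKernel {m : ℕ∞} : ContDiff ℝ m (radialKernel : E → ℝ) := by
  have h := expNegInvGlue.contDiff_polynomial_eval_inv_mul (n := m) (Polynomial.X ^ 2)
  simp only [Polynomial.eval_pow, Polynomial.eval_X] at h
  exact contDiff_const.mul (h.comp (contDiff_const.sub (contDiff_norm_sq ℝ)))

theorem hasFDerivAt_radialPotential (x : E) :
    HasFDerivAt radialPotential (-(radialKernel x) • innerSL ℝ x) x := by
  have h := expNegInvGlue.hasDerivAt_polynomial_eval_inv_mul 1 (1 - ‖x‖ ^ 2)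
  simp only [Polynomial.eval_one, one_mul, Polynomial.derivative_one, sub_zero, mul_one,
    Polynomial.eval_pow, Polynomial.eval_X] at h
  have h2 : HasFDerivAt (fun x : E ↦ 1 - ‖x‖ ^ 2) (-(2 • innerSL ℝ x)) x :=
    (hasStrictFDerivAt_norm_sq x).hasFDerivAt.const_sub 1
  refine (h.comp_hasFDerivAt x h2).congr_fderiv ?_
  ext v
  simp [radialKernel]
  ring

variable [FiniteDimensional ℝ E]

theorem hasCompactSupport_radialPotential : HasCompactSupport (radialPotential : E → ℝ) :=
  HasCompactSupport.of_support_subset_isCompact (isCompact_closedBall 0 1) fun x hx ↦ by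
    by_contra h
    exact hx (radialPotential_eq_zero (by simpa using (not_le.1 (by simpa using h)).le))

theorem hasCompactSupport_radialKernel : HasCompactSupport (radialKernel : E → ℝ) :=
  HasCompactSupport.of_support_subset_isCompact (isCompact_closedBall 0 1) fun x hx ↦ by
    by_contra h
    exact hx (radialKernel_eq_zero (by simpa using (not_le.1 (by simpa using h)).le))

theorem integral_radialKernel_pos [MeasurableSpace E] [BorelSpace E] :
    0 < ∫ x : E, radialKernel x :=
  (contDiff_radialKernel (m := 0)).continuous.integral_pos_of_hasCompactSupport_nonneg_nonzero
    hasCompactSupport_radialKernel radialKernel_nonneg radialKernel_zero_ne_zero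

end RadialKernel

/-! ### Mean value property for a smooth radial density -/

section MeanValue

open InnerProductSpace

variable {E F : Type*} [NormedAddCommGroup E] [InnerProductSpace ℝ E] [FiniteDimensional ℝ E]
  [NormedAddCommGroup F] [NormedSpace ℝ F]

theorem laplacian_eq_sum_fderiv_fderiv {ι : Type*} [Fintype ι] (b : OrthonormalBasis ι ℝ E)
    {f : E → F} {x : E} (hf : ContDiffAt ℝ 2 f x) :
    Laplacian.laplacian f x = ∑ i, fderiv ℝ (fun z ↦ fderiv ℝ f z (b i)) x (b i) := by
  rw [laplacian_eq_iteratedFDeriv_orthonormalBasis f b]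
  refine Finset.sum_congr rfl fun i _ ↦ ?_
  have h : DifferentiableAt ℝ (fderiv ℝ f) x :=
    (hf.fderiv_right (m := 1) (by norm_num)).differentiableAt (by norm_num)
  rw [iteratedFDeriv_two_apply, fderiv_clm_apply h (by fun_prop)]
  simp

variable [MeasurableSpace E] [BorelSpace E]

/-- The field `radialKernel x • x` is minus the gradient of the potential, so integrating by parts
in each coordinate turns the radial derivative into a Laplacian; the factor `r` is the chain rule.
The left side is the `r`-derivative of the weighted mean of `f`. -/
theorem integral_radialKernel_smul_fderiv {f : E → F} (hf : ContDiff ℝ 2 f) (y : E) (r : ℝ) :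
    ∫ x, radialKernel x • fderiv ℝ f (y + r • x) x =
      r • ∫ x, radialPotential x • Laplacian.laplacian f (y + r • x) := by
  let b := stdOrthonormalBasis ℝ E
  have hdf : ContDiff ℝ 1 (fderiv ℝ f) := hf.fderiv_right (by norm_num)
  have hG (i) : ContDiff ℝ 1 (fun z : E ↦ fderiv ℝ f (y + r • z) (b i)) := by
    have : ContDiff ℝ 1 (fun z : E ↦ fderiv ℝ f (y + r • z)) := hdf.comp (by fun_prop)
    exact this.clm_apply contDiff_const
  have hpot : ContDiff ℝ 1 (radialPotential : E → ℝ) := contDiff_radialPotential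
  have hpot' (v : E) : Continuous fun x ↦ fderiv ℝ (radialPotential : E → ℝ) x v :=
    (hpot.continuous_fderiv (by norm_num)).clm_apply continuous_const
  have hG' (i) (v : E) :
      Continuous fun x ↦ fderiv ℝ (fun z : E ↦ fderiv ℝ f (y + r • z) (b i)) x v :=
    ((hG i).continuous_fderiv (by norm_num)).clm_apply continuous_const
  have hpot's (v : E) : HasCompactSupport fun x ↦ fderiv ℝ (radialPotential : E → ℝ) x v :=
    hasCompactSupport_radialPotential.fderiv_apply ℝ v
  have hI1 (i) : Integrable fun x ↦ radialPotential x •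
      fderiv ℝ (fun z : E ↦ fderiv ℝ f (y + r • z) (b i)) x (b i) :=
    (hpot.continuous.smul (hG' i _)).integrable_of_hasCompactSupport
      hasCompactSupport_radialPotential.smul_right
  have hI2 (i) : Integrable fun x ↦ fderiv ℝ (radialPotential : E → ℝ) x (b i) •
      fderiv ℝ f (y + r • x) (b i) :=
    ((hpot' _).smul (hG i).continuous).integrable_of_hasCompactSupport
      (hpot's _).smul_right
  have hI3 (i) : Integrable fun x ↦ (radialPotential : E → ℝ) x •
      fderiv ℝ f (y + r • x) (b i) :=
    (hpot.continuous.smul (hG i).continuous).integrable_of_hasCompactSupport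
      hasCompactSupport_radialPotential.smul_right
  have hparts (i) := integral_smul_fderiv_eq_neg_fderiv_smul_of_integrable
    (μ := volume) (hI2 i) (hI1 i) (hI3 i)
    (fun x _ ↦ hpot.differentiable (by norm_num) x)
    (fun x _ ↦ (hG i).differentiable (by norm_num) x)
  have h1 (x : E) : radialKernel x • fderiv ℝ f (y + r • x) x =
      ∑ i, -(fderiv ℝ (radialPotential : E → ℝ) x (b i) • fderiv ℝ f (y + r • x) (b i)) := by
    conv_lhs => rw [← b.sum_repr x, map_sum, Finset.smul_sum]
    rw [b.sum_repr x]
    refine Finset.sum_congr rfl fun i _ ↦ ?_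
    rw [(hasFDerivAt_radialPotential x).fderiv, map_smul, smul_smul, ← neg_smul,
      b.repr_apply_apply, real_inner_comm]
    simp
  have h2 (x : E) : r • (radialPotential x • Laplacian.laplacian f (y + r • x)) =
      ∑ i, radialPotential x • fderiv ℝ (fun z : E ↦ fderiv ℝ f (y + r • z) (b i)) x (b i) := by
    rw [laplacian_eq_sum_fderiv_fderiv b hf.contDiffAt, smul_comm, Finset.smul_sum,
      Finset.smul_sum]
    refine Finset.sum_congr rfl fun i _ ↦ ?_
    have hd : DifferentiableAt ℝ (fun z ↦ fderiv ℝ f z (b i)) (y + r • x) :=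
      (hdf.clm_apply contDiff_const).differentiable (by norm_num) _
    have hin : HasFDerivAt (fun z : E ↦ y + r • z) (r • ContinuousLinearMap.id ℝ E) x :=
      ((hasFDerivAt_id x).const_smul r).const_add y
    have := (hd.hasFDerivAt.comp x hin).fderiv
    simp only [Function.comp_def] at this
    rw [this]
    simp
  rw [← integral_smul]
  simp_rw [h1, h2, Finset.sum_neg_distrib]
  rw [integral_neg, integral_finsetSum _ fun i _ ↦ hI2 i, integral_finsetSum _ fun i _ ↦ hI1 i,
    ← Finset.sum_neg_distrib]
  exact Finset.sum_congr rfl fun i _ ↦ (hparts i).symm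

theorem hasDerivAt_integral_radialKernel_smul {f : E → F} (hf : ContDiff ℝ 2 f)
    (hfs : HasCompactSupport f) (y : E) (r : ℝ) :
    HasDerivAt (fun r : ℝ ↦ ∫ x, radialKernel x • f (y + r • x))
      (∫ x, radialKernel x • fderiv ℝ f (y + r • x) x) r := by
  have hk : Continuous (radialKernel : E → ℝ) := (contDiff_radialKernel (m := 0)).continuous
  have hdf : Continuous (fderiv ℝ f) := hf.continuous_fderiv (by norm_num)
  obtain ⟨M, hM⟩ := hdf.bounded_above_of_compact_support (hfs.fderiv ℝ)
  have hc (s : ℝ) : Continuous fun x : E ↦ radialKernel x • f (y + s • x) :=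
    hk.smul (hf.continuous.comp (by fun_prop))
  have hc' (s : ℝ) : Continuous fun x : E ↦ radialKernel x • fderiv ℝ f (y + s • x) x :=
    hk.smul ((hdf.comp (by fun_prop)).clm_apply continuous_id)
  refine (hasDerivAt_integral_of_dominated_loc_of_deriv_le (s := Set.univ)
    (F' := fun s x ↦ radialKernel x • fderiv ℝ f (y + s • x) x)
    (bound := fun x ↦ radialKernel x * (M * ‖x‖)) univ_mem
    (.of_forall fun s ↦ (hc s).aestronglyMeasurable) ?_ (hc' r).aestronglyMeasurable ?_ ?_ ?_).2
  · exact (hc r).integrable_of_hasCompactSupport hasCompactSupport_radialKernel.smul_right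
  · refine .of_forall fun x s _ ↦ ?_
    rw [norm_smul, Real.norm_of_nonneg (radialKernel_nonneg x)]
    exact mul_le_mul_of_nonneg_left ((fderiv ℝ f (y + s • x)).le_of_opNorm_le (hM _) x)
      (radialKernel_nonneg x)
  · exact (hk.mul (by fun_prop)).integrable_of_hasCompactSupport
      hasCompactSupport_radialKernel.mul_right
  · refine .of_forall fun x s _ ↦ ?_
    have hin : HasDerivAt (fun s : ℝ ↦ y + s • x) x s := by
      simpa using ((hasDerivAt_id s).smul_const x).const_add y
    exact (((hf.differentiable (by norm_num) _).hasFDerivAt.comp_hasDerivAt s hin)).const_smul _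

/-- The weighted mean has zero derivative in the radius while the ball stays where the Laplacian
vanishes, so it equals its value at radius zero. -/
theorem integral_radialKernel_smul_of_laplacian_eq_zero [CompleteSpace F] {f : E → F}
    (hf : ContDiff ℝ 2 f)
    (hfs : HasCompactSupport f) {y : E} {R r : ℝ} (hr : 0 ≤ r) (hrR : r < R)
    (hΔ : ∀ x ∈ Metric.ball y R, Laplacian.laplacian f x = 0) :
    ∫ x, radialKernel x • f (y + r • x) = (∫ x : E, radialKernel x) • f y := by
  have h0 : ∀ s ∈ Set.Ico 0 r, HasDerivWithinAt
      (fun r : ℝ ↦ ∫ x, radialKernel x • f (y + r • x)) 0 (Set.Ici s) s := by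
    intro s hs
    have h := hasDerivAt_integral_radialKernel_smul hf hfs y s
    rw [integral_radialKernel_smul_fderiv hf] at h
    have hz (x : E) : radialPotential x • Laplacian.laplacian f (y + s • x) = 0 := by
      rcases le_or_gt 1 ‖x‖ with hx | hx
      · rw [radialPotential_eq_zero hx, zero_smul]
      · rw [hΔ, smul_zero]
        rw [mem_ball_iff_norm, add_sub_cancel_left, norm_smul, Real.norm_of_nonneg hs.1]
        nlinarith [hs.1, hs.2, norm_nonneg x]
    simp_rw [hz] at h
    simpa using h.hasDerivWithinAt
  have := constant_of_has_deriv_right_zero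
    (fun s _ ↦ (hasDerivAt_integral_radialKernel_smul hf hfs y s).continuousAt.continuousWithinAt)
    h0 r ⟨hr, le_rfl⟩
  rw [this]
  simp only [zero_smul, add_zero]
  exact integral_smul_const _ _

/-- The kernel `radialKernel`, rescaled to have integral one and support in the closed ball of
radius `r`. -/
noncomputable def meanKernel (r : ℝ) (x : E) : ℝ :=
  (r ^ Module.finrank ℝ E * ∫ z : E, radialKernel z)⁻¹ * radialKernel (r⁻¹ • x)

theorem contDiff_meanKernel {m : ℕ∞} (r : ℝ) : ContDiff ℝ m (meanKernel r : E → ℝ) :=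
  contDiff_const.mul (contDiff_radialKernel.comp (contDiff_const_smul _))

theorem meanKernel_eq_zero {r : ℝ} (hr : 0 < r) {x : E} (hx : r ≤ ‖x‖) : meanKernel r x = 0 := by
  rw [meanKernel, radialKernel_eq_zero, mul_zero]
  rw [norm_smul, norm_inv, Real.norm_of_nonneg hr.le]
  field_simp
  exact hx

theorem hasCompactSupport_meanKernel {r : ℝ} (hr : 0 < r) :
    HasCompactSupport (meanKernel r : E → ℝ) :=
  HasCompactSupport.of_support_subset_isCompact (isCompact_closedBall 0 r) fun x hx ↦ by
    by_contra h
    exact hx (meanKernel_eq_zero hr (by simpa using (not_le.1 (by simpa using h)).le))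

/-- The mean value property of harmonic functions with respect to a smooth radial density. -/
theorem InnerProductSpace.HarmonicOnNhd.integral_meanKernel_smul [CompleteSpace F] {h : E → F}
    {y : E} {R r : ℝ} (hr : 0 < r) (hrR : r < R) (hh : HarmonicOnNhd h (Metric.ball y R)) :
    ∫ x, meanKernel r (y - x) • h x = h y := by
  -- The cutoff radii lie strictly between `r` and `R`: `f` agrees with `h` on a ball of radius
  -- larger than `r`, yet is `C²` with compact support on the whole space.
  let χ : ContDiffBump y := ⟨(2 * r + R) / 3, (r + 2 * R) / 3, by linarith, by linarith⟩
  let f : E → F := fun x ↦ χ x • h x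
  have hfs : HasCompactSupport f := χ.hasCompactSupport.smul_right
  have hf : ContDiff ℝ 2 f := by
    rw [contDiff_iff_contDiffAt]
    intro x
    by_cases hx : x ∈ tsupport χ
    · rw [χ.tsupport_eq] at hx
      refine χ.contDiffAt.smul (hh x ?_).1
      exact Metric.closedBall_subset_ball (by simp only [χ]; linarith) hx
    · have : f =ᶠ[𝓝 x] fun _ ↦ 0 := by
        filter_upwards [notMem_tsupport_iff_eventuallyEq.1 hx] with z hz
        simp [f, hz]
      exact contDiffAt_const.congr_of_eventuallyEq this
  have hfh {x : E} (hx : x ∈ Metric.ball y ((2 * r + R) / 3)) : f x = h x := by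
    simp only [f]
    rw [χ.one_of_mem_closedBall (Metric.ball_subset_closedBall hx), one_smul]
  have hΔ : ∀ x ∈ Metric.ball y ((2 * r + R) / 3), Laplacian.laplacian f x = 0 := by
    intro x hx
    have : f =ᶠ[𝓝 x] h := by
      filter_upwards [Metric.isOpen_ball.mem_nhds hx] with z hz using hfh hz
    rw [(laplacian_congr_nhds this).self_of_nhds]
    exact (hh x (Metric.ball_subset_ball (by linarith) hx)).2.self_of_nhds
  have key := integral_radialKernel_smul_of_laplacian_eq_zero hf hfs hr.le
    (show r < (2 * r + R) / 3 by linarith) hΔ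
  have hc := integral_radialKernel_pos (E := E)
  have hfy : f y = h y := hfh (Metric.mem_ball_self (by linarith))
  have h1 : ∫ x, meanKernel r (y - x) • h x = ∫ x, meanKernel r x • f (y + x) := by
    rw [← integral_add_left_eq_self (fun x ↦ meanKernel r (y - x) • h x) y]
    congr 1 with x
    rw [sub_add_cancel_left, meanKernel, smul_neg, radialKernel_neg, ← meanKernel]
    rcases le_or_gt r ‖x‖ with hx | hx
    · simp [meanKernel_eq_zero hr hx]
    · rw [hfh]
      simp only [mem_ball_iff_norm, add_sub_cancel_left]
      linarith
  have h2 := Measure.integral_comp_inv_smul (μ := (volume : Measure E))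
    (fun x ↦ radialKernel x • f (y + r • x)) r
  simp only [smul_inv_smul₀ hr.ne'] at h2
  rw [h1]
  simp only [meanKernel, mul_smul]
  rw [integral_smul, h2, key, hfy, abs_of_pos (pow_pos hr _), smul_smul, smul_smul, mul_assoc,
    inv_mul_cancel₀ (by positivity), one_smul]

end MeanValue

/-! ### Limits of harmonic functions in `L¹` -/

section ConvolutionLaplacian

open InnerProductSpace

variable {E : Type*} [NormedAddCommGroup E] [InnerProductSpace ℝ E] [FiniteDimensional ℝ E]

theorem hasCompactSupport_laplacian {K : E → ℝ} (hKs : HasCompactSupport K) :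
    HasCompactSupport (Laplacian.laplacian K) := by
  refine hKs.mono' fun x hx ↦ ?_
  by_contra h
  have : K =ᶠ[𝓝 x] fun _ ↦ 0 := notMem_tsupport_iff_eventuallyEq.1 h
  exact hx (by rw [(laplacian_congr_nhds this).self_of_nhds, laplacian_const]; rfl)

theorem continuous_laplacian {K : E → ℝ} (hK : ContDiff ℝ 2 K) :
    Continuous (Laplacian.laplacian K) := by
  let b := stdOrthonormalBasis ℝ E
  have h : Laplacian.laplacian K =
      fun x ↦ ∑ i, fderiv ℝ (fun z ↦ fderiv ℝ K z (b i)) x (b i) := by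
    ext x
    exact laplacian_eq_sum_fderiv_fderiv b hK.contDiffAt
  rw [h]
  have h1 (i) : ContDiff ℝ 1 (fun z ↦ fderiv ℝ K z (b i)) :=
    (hK.fderiv_right (m := 1) (by norm_num)).clm_apply contDiff_const
  exact continuous_finsetSum _ fun i _ ↦
    ((h1 i).continuous_fderiv (by norm_num)).clm_apply continuous_const

variable {F : Type*} [MeasurableSpace E] [BorelSpace E] [NormedAddCommGroup F]
  [NormedSpace ℝ F]

theorem hasFDerivAt_integral_smul_translate {K : E → ℝ} {u : E → F} (hK : ContDiff ℝ 1 K)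
    (hKs : HasCompactSupport K) (hu : LocallyIntegrable u) (x v : E) :
    DifferentiableAt ℝ (fun y ↦ ∫ t, K (y - t) • u t) x ∧
      fderiv ℝ (fun y ↦ ∫ t, K (y - t) • u t) x v = ∫ t, fderiv ℝ K (x - t) v • u t := by
  have h := hKs.hasFDerivAt_convolution_right (μ := volume)
    (ContinuousLinearMap.lsmul ℝ ℝ (E := F)).flip hu hK x
  have heq : convolution u K (ContinuousLinearMap.lsmul ℝ ℝ (E := F)).flip volume =
      fun y ↦ ∫ t, K (y - t) • u t := by
    ext y
    simp [convolution_def]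
  rw [heq] at h
  refine ⟨h.differentiableAt, ?_⟩
  rw [h.fderiv, convolution_precompR_apply _ hu (hKs.fderiv ℝ)
    (hK.continuous_fderiv (by norm_num))]
  simp [convolution_def]

theorem contDiff_integral_smul_translate {K : E → ℝ} {u : E → F} {m : ℕ∞} (hK : ContDiff ℝ m K)
    (hKs : HasCompactSupport K) (hu : LocallyIntegrable u) :
    ContDiff ℝ m (fun y ↦ ∫ t, K (y - t) • u t) := by
  have h := hKs.contDiff_convolution_right (μ := volume)
    (ContinuousLinearMap.lsmul ℝ ℝ (E := F)).flip hu hK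
  convert h using 2
  simp [convolution_def]

theorem integrable_smul_translate {K : E → ℝ} {u : E → F} (hK : Continuous K)
    (hKs : HasCompactSupport K) (hu : Integrable u) (y : E) :
    Integrable fun t ↦ K (y - t) • u t := by
  obtain ⟨M, hM⟩ := hK.bounded_above_of_compact_support hKs
  exact hu.bdd_smul M (by fun_prop) (.of_forall fun t ↦ hM _)

theorem laplacian_integral_smul_translate {K : E → ℝ} {u : E → F} (hK : ContDiff ℝ 2 K)
    (hKs : HasCompactSupport K) (hu : Integrable u) (x : E) :
    Laplacian.laplacian (fun y ↦ ∫ t, K (y - t) • u t) x =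
      ∫ t, Laplacian.laplacian K (x - t) • u t := by
  let b := stdOrthonormalBasis ℝ E
  have hu' := hu.locallyIntegrable
  have h1 (i) : ContDiff ℝ 1 (fun z ↦ fderiv ℝ K z (b i)) :=
    (hK.fderiv_right (m := 1) (by norm_num)).clm_apply contDiff_const
  have h1s (i) : HasCompactSupport (fun z ↦ fderiv ℝ K z (b i)) := hKs.fderiv_apply ℝ _
  rw [laplacian_eq_sum_fderiv_fderiv b
    (contDiff_integral_smul_translate (m := 2) (mod_cast hK) hKs hu').contDiffAt]
  have h2 (i) : (fun z ↦ fderiv ℝ (fun y ↦ ∫ t, K (y - t) • u t) z (b i)) =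
      fun z ↦ ∫ t, fderiv ℝ K (z - t) (b i) • u t := by
    ext z
    exact (hasFDerivAt_integral_smul_translate (hK.of_le (by norm_num)) hKs hu' z _).2
  simp_rw [h2, fun i ↦ (hasFDerivAt_integral_smul_translate (h1 i) (h1s i) hu' x (b i)).2,
    laplacian_eq_sum_fderiv_fderiv b hK.contDiffAt, Finset.sum_smul]
  rw [integral_finsetSum]
  intro i _
  exact integrable_smul_translate (((h1 i).continuous_fderiv (by norm_num)).clm_apply
    continuous_const) ((h1s i).fderiv_apply ℝ _) hu x

theorem tendsto_integral_smul_translate {K : E → ℝ} {u : ℕ → E → F} {f : E → F}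
    (hK : Continuous K) (hKs : HasCompactSupport K) (hu : ∀ k, Integrable (u k))
    (hf : Integrable f) (hlim : Tendsto (fun k ↦ eLpNorm (u k - f) 1) atTop (𝓝 0)) (y : E) :
    Tendsto (fun k ↦ ∫ t, K (y - t) • u k t) atTop (𝓝 (∫ t, K (y - t) • f t)) := by
  obtain ⟨M, hM⟩ := hK.bounded_above_of_compact_support hKs
  refine tendsto_integral_of_L1 _ (integrable_smul_translate hK hKs hf y).aestronglyMeasurable
    (.of_forall fun k ↦ integrable_smul_translate hK hKs (hu k) y) ?_
  have hlim' : Tendsto (fun k ↦ ENNReal.ofReal M * eLpNorm (u k - f) 1) atTop (𝓝 0) := by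
    simpa using ENNReal.Tendsto.const_mul hlim (.inr ENNReal.ofReal_ne_top)
  refine tendsto_of_tendsto_of_tendsto_of_le_of_le tendsto_const_nhds hlim' (fun _ ↦ zero_le)
    fun k ↦ ?_
  simp only
  rw [eLpNorm_one_eq_lintegral_enorm, ← lintegral_const_mul'']
  · refine lintegral_mono fun t ↦ ?_
    rw [← smul_sub, enorm_smul, Pi.sub_apply]
    gcongr
    rw [← ofReal_norm]
    exact ENNReal.ofReal_le_ofReal (hM _)
  · exact ((hu k).sub hf).aestronglyMeasurable.enorm

/-- Harmonic functions converging in `L¹` on a ball converge near its center to a harmonic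
function. -/
theorem exists_harmonicOnNhd_tendsto_of_tendsto_eLpNorm [CompleteSpace F] {u : ℕ → E → F}
    {f : E → F} {y : E} {r : ℝ} (hr : 0 < r)
    (hu : ∀ k, HarmonicOnNhd (u k) (Metric.ball y (3 * r)))
    (hui : ∀ k, IntegrableOn (u k) (Metric.ball y (3 * r)))
    (hf : IntegrableOn f (Metric.ball y (3 * r)))
    (hlim : Tendsto (fun k ↦ eLpNorm (u k - f) 1 (volume.restrict (Metric.ball y (3 * r))))
      atTop (𝓝 0)) :
    ∃ g : E → F, HarmonicOnNhd g (Metric.ball y r) ∧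
      ∀ x ∈ Metric.ball y r, Tendsto (fun k ↦ u k x) atTop (𝓝 (g x)) := by
  set B := Metric.ball y (3 * r)
  have hB : MeasurableSet B := Metric.isOpen_ball.measurableSet
  let K : E → ℝ := meanKernel r
  have hK : ContDiff ℝ 2 K := contDiff_meanKernel (m := 2) r
  have hKs : HasCompactSupport K := hasCompactSupport_meanKernel hr
  have hui' (k) : Integrable (B.indicator (u k)) := (hui k).integrable_indicator hB
  have hf' : Integrable (B.indicator f) := hf.integrable_indicator hB
  have hlim' : Tendsto (fun k ↦ eLpNorm (B.indicator (u k) - B.indicator f) 1) atTop (𝓝 0) := by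
    refine hlim.congr fun k ↦ ?_
    rw [← Set.indicator_sub', eLpNorm_indicator_eq_eLpNorm_restrict hB]
  -- For `x` within `r` of the center, the ball of radius `2 * r` about `x` stays in `B` and
  -- contains the support of the mean kernel, so one fixed `K` reproduces every `u k`.
  have hrep (k) {x : E} (hx : x ∈ Metric.ball y r) :
      ∫ t, K (x - t) • B.indicator (u k) t = u k x := by
    have hxB : Metric.ball x (2 * r) ⊆ B := by
      refine Metric.ball_subset_ball' ?_
      rw [Metric.mem_ball] at hx
      linarith
    rw [← ((hu k).mono hxB).integral_meanKernel_smul hr (by linarith)]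
    congr 1 with t
    by_cases ht : t ∈ B
    · rw [Set.indicator_of_mem ht]
    · have : meanKernel r (x - t) = 0 := by
        refine meanKernel_eq_zero hr ?_
        by_contra hlt
        refine ht (hxB ?_)
        rw [Metric.mem_ball, dist_comm, dist_eq_norm]
        linarith
      simp [K, this]
  -- No convergence of derivatives is needed: the Laplacian falls on `K`, and pairing with the
  -- bounded function `ΔK` is continuous in `L¹`. The pairings with `u k` all vanish, hence so does
  -- the limit.
  have hlap {x : E} (hx : x ∈ Metric.ball y r) :
      Laplacian.laplacian (fun z ↦ ∫ t, K (z - t) • B.indicator f t) x = 0 := by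
    rw [laplacian_integral_smul_translate hK hKs hf']
    refine tendsto_nhds_unique (tendsto_integral_smul_translate (continuous_laplacian hK)
      (hasCompactSupport_laplacian hKs) hui' hf' hlim' x) ?_
    refine tendsto_const_nhds.congr fun k ↦ ?_
    rw [← laplacian_integral_smul_translate hK hKs (hui' k)]
    have hev : (fun z ↦ ∫ t, K (z - t) • B.indicator (u k) t) =ᶠ[𝓝 x] u k := by
      filter_upwards [Metric.isOpen_ball.mem_nhds hx] with z hz using hrep k hz
    rw [(laplacian_congr_nhds hev).self_of_nhds]
    exact (hu k x (Metric.ball_subset_ball (by linarith) hx)).2.self_of_nhds.symm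
  refine ⟨fun z ↦ ∫ t, K (z - t) • B.indicator f t, fun x hx ↦ ⟨?_, ?_⟩, fun x hx ↦ ?_⟩
  · exact (contDiff_integral_smul_translate (m := 2) (mod_cast hK) hKs
      hf'.locallyIntegrable).contDiffAt
  · filter_upwards [Metric.isOpen_ball.mem_nhds hx] with z hz using hlap hz
  · exact (tendsto_integral_smul_translate hK.continuous hKs hui' hf' hlim' x).congr
      fun k ↦ hrep k hx

/-- Harmonic functions on an open set that converge locally in `L¹` converge pointwise to a harmonic
function. -/
theorem exists_harmonicOnNhd_tendsto_of_locally_tendsto_eLpNorm [CompleteSpace F] {Ω : Set E}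
    (hΩ : IsOpen Ω) {u : ℕ → E → F} {f : E → F} (hu : ∀ k, HarmonicOnNhd (u k) Ω)
    (hf : ∀ S ⊆ Ω, IsCompact S → IntegrableOn f S)
    (hlim : ∀ S ⊆ Ω, IsCompact S →
      Tendsto (fun k ↦ eLpNorm (u k - f) 1 (volume.restrict S)) atTop (𝓝 0)) :
    ∃ g : E → F, HarmonicOnNhd g Ω ∧ ∀ x ∈ Ω, Tendsto (fun k ↦ u k x) atTop (𝓝 (g x)) := by
  have key : ∀ y ∈ Ω, ∃ r > 0, ∃ g : E → F, HarmonicOnNhd g (Metric.ball y r) ∧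
      ∀ x ∈ Metric.ball y r, Tendsto (fun k ↦ u k x) atTop (𝓝 (g x)) := by
    intro y hy
    obtain ⟨R, hR, hRΩ⟩ := Metric.nhds_basis_closedBall.mem_iff.1 (hΩ.mem_nhds hy)
    have hr : 0 < R / 3 := by positivity
    have h3 : 3 * (R / 3) = R := by ring
    have hS := isCompact_closedBall y R
    have hb : Metric.ball y (3 * (R / 3)) ⊆ Metric.closedBall y R := by
      rw [h3]
      exact Metric.ball_subset_closedBall
    refine ⟨R / 3, hr, exists_harmonicOnNhd_tendsto_of_tendsto_eLpNorm (f := f) hr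
      (fun k ↦ (hu k).mono (hb.trans hRΩ)) (fun k ↦ ?_) ((hf _ hRΩ hS).mono_set hb) ?_⟩
    · exact (((hu k).mono hRΩ).continuousOn.integrableOn_compact hS).mono_set hb
    · exact tendsto_of_tendsto_of_tendsto_of_le_of_le tendsto_const_nhds (hlim _ hRΩ hS)
        (fun _ ↦ zero_le) fun k ↦ eLpNorm_mono_measure _ (Measure.restrict_mono_set _ hb)
  choose! r hr g hg hgl using key
  have hl {x : E} (hx : x ∈ Ω) := hgl x hx x (Metric.mem_ball_self (hr x hx))
  -- The local limits glue because each is the pointwise limit of the same sequence.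
  refine ⟨fun x ↦ g x x, fun y hy ↦ ?_, fun x hx ↦ hl hx⟩
  refine (harmonicAt_congr_nhds ?_).1 (hg y hy y (Metric.mem_ball_self (hr y hy)))
  filter_upwards [hΩ.mem_nhds hy, Metric.ball_mem_nhds y (hr y hy)] with z hz hzb
  exact tendsto_nhds_unique (hgl y hy z hzb) (hl hz)

end ConvolutionLaplacian

/-! ### Weighted measure against Lebesgue measure -/

section WeightedMeasure

variable {n : ℕ} {Ω : Set (EuclideanSpace ℝ (Fin n))} {w : EuclideanSpace ℝ (Fin n) → ℝ}

theorem weightedMeasure_absolutelyContinuous :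
    weightedMeasure Ω w ≪ volume.restrict Ω :=
  withDensity_absolutelyContinuous _ _

theorem restrict_le_smul_weightedMeasure {S : Set (EuclideanSpace ℝ (Fin n))}
    (hS : MeasurableSet S) (hSΩ : S ⊆ Ω) {c : ℝ} (hc : 0 < c) (hcw : ∀ x ∈ S, c ≤ w x) :
    volume.restrict S ≤ (ENNReal.ofReal c)⁻¹ • weightedMeasure Ω w := by
  refine Measure.le_iff.2 fun t ht ↦ ?_
  rw [Measure.smul_apply, smul_eq_mul, weightedMeasure, withDensity_apply _ ht,
    Measure.restrict_restrict ht, Measure.restrict_apply ht]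
  have h1 : ENNReal.ofReal c * volume (t ∩ S) ≤ ∫⁻ x in t ∩ Ω, ENNReal.ofReal (w x) := by
    rw [← setLIntegral_const]
    refine (setLIntegral_mono_ae' (ht.inter hS) (.of_forall fun x hx ↦ ?_)).trans
      (lintegral_mono_set (Set.inter_subset_inter_right t hSΩ))
    exact ENNReal.ofReal_le_ofReal (hcw x hx.2)
  calc volume (t ∩ S) = (ENNReal.ofReal c)⁻¹ * (ENNReal.ofReal c * volume (t ∩ S)) := by
        rw [← mul_assoc, ENNReal.inv_mul_cancel (by simpa using hc) ENNReal.ofReal_ne_top, one_mul]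
    _ ≤ _ := by gcongr

theorem exists_restrict_le_smul_weightedMeasure (hw : ContinuousOn w Ω)
    (hpos : ∀ x ∈ Ω, 0 < w x) {S : Set (EuclideanSpace ℝ (Fin n))} (hS : IsCompact S)
    (hSΩ : S ⊆ Ω) :
    ∃ C : ENNReal, C ≠ ⊤ ∧ volume.restrict S ≤ C • weightedMeasure Ω w := by
  obtain ⟨c, hc, hcw⟩ := hS.exists_forall_le' (hw.mono hSΩ) (a := 0) fun x hx ↦ hpos x (hSΩ hx)
  exact ⟨_, by simpa using hc, restrict_le_smul_weightedMeasure hS.measurableSet hSΩ hc hcw⟩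

/-- On a compact subset the weight is bounded below, and Hölder on a set of finite volume passes
from `L²` to `L¹`. -/
theorem exists_eLpNorm_one_restrict_le (hw : ContinuousOn w Ω)
    (hpos : ∀ x ∈ Ω, 0 < w x) {S : Set (EuclideanSpace ℝ (Fin n))} (hS : IsCompact S)
    (hSΩ : S ⊆ Ω) :
    ∃ C : ENNReal, C ≠ ⊤ ∧ ∀ f : EuclideanSpace ℝ (Fin n) → ℂ,
      AEStronglyMeasurable f (volume.restrict S) →
      eLpNorm f 1 (volume.restrict S) ≤ C * eLpNorm f 2 (weightedMeasure Ω w) := by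
  obtain ⟨C, hC, hle⟩ := exists_restrict_le_smul_weightedMeasure hw hpos hS hSΩ
  refine ⟨C ^ (1 / (2 : ENNReal)).toReal * volume S ^ ((1 : ℝ) / 2), ?_, fun f hf ↦ ?_⟩
  · exact ENNReal.mul_ne_top (ENNReal.rpow_ne_top_of_nonneg (by simp) hC)
      (ENNReal.rpow_ne_top_of_nonneg (by simp) hS.measure_lt_top.ne)
  · have h1 := eLpNorm_le_eLpNorm_mul_rpow_measure_univ (p := 1) (q := 2) (by norm_num) hf
    have h2 := eLpNorm_mono_measure (p := 2) f hle
    rw [eLpNorm_smul_measure_of_ne_top (by norm_num)] at h2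
    refine h1.trans ((mul_le_mul_left h2 _).trans_eq ?_)
    simp only [smul_eq_mul, Measure.restrict_apply_univ, ENNReal.toReal_one, ENNReal.toReal_ofNat]
    rw [mul_right_comm]
    norm_num

theorem aemeasurable_ofReal_restrict (hΩ : IsOpen Ω) (hw : ContinuousOn w Ω) :
    AEMeasurable (fun x ↦ ENNReal.ofReal (w x)) (volume.restrict Ω) :=
  (hw.aemeasurable hΩ.measurableSet).ennreal_ofReal

theorem integral_weightedMeasure {F : Type*} [NormedAddCommGroup F] [NormedSpace ℝ F]
    (hΩ : IsOpen Ω) (hw : ContinuousOn w Ω) (hpos : ∀ x ∈ Ω, 0 < w x)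
    (f : EuclideanSpace ℝ (Fin n) → F) :
    ∫ x, f x ∂(weightedMeasure Ω w) = ∫ x in Ω, w x • f x := by
  rw [weightedMeasure, integral_withDensity_eq_integral_toReal_smul₀
    (aemeasurable_ofReal_restrict hΩ hw) (.of_forall fun _ ↦ ENNReal.ofReal_lt_top)]
  refine setIntegral_congr_fun hΩ.measurableSet fun x hx ↦ ?_
  rw [ENNReal.toReal_ofReal (hpos x hx).le]

theorem integrable_weightedMeasure_iff {F : Type*} [NormedAddCommGroup F] [NormedSpace ℝ F]
    (hΩ : IsOpen Ω) (hw : ContinuousOn w Ω) (hpos : ∀ x ∈ Ω, 0 < w x)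
    {f : EuclideanSpace ℝ (Fin n) → F} :
    Integrable f (weightedMeasure Ω w) ↔ IntegrableOn (fun x ↦ w x • f x) Ω := by
  rw [weightedMeasure, integrable_withDensity_iff_integrable_smul₀'
    (aemeasurable_ofReal_restrict hΩ hw) (.of_forall fun _ ↦ ENNReal.ofReal_lt_top)]
  refine integrableOn_congr_fun (fun x hx ↦ ?_) hΩ.measurableSet
  rw [ENNReal.toReal_ofReal (hpos x hx).le]

theorem aestronglyMeasurable_weightedMeasure {F : Type*} [NormedAddCommGroup F]
    (hΩ : IsOpen Ω) {f : EuclideanSpace ℝ (Fin n) → F} (hf : ContinuousOn f Ω) :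
    AEStronglyMeasurable f (weightedMeasure Ω w) :=
  (hf.aestronglyMeasurable hΩ.measurableSet).mono_ac weightedMeasure_absolutelyContinuous

end WeightedMeasure

/-! ### Inner products in `L²` as integrals -/

section InnerToLp

variable {X : Type*} [MeasurableSpace X] {μ : Measure X} {f g : X → ℂ}

theorem inner_toLp_toLp (hf : MemLp f 2 μ) (hg : MemLp g 2 μ) :
    inner ℂ (hg.toLp g) (hf.toLp f) = ∫ x, f x * (starRingEnd ℂ) (g x) ∂μ := by
  rw [L2.inner_def]
  refine integral_congr_ae ?_
  filter_upwards [hf.coeFn_toLp, hg.coeFn_toLp] with x hx hy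
  rw [hx, hy, RCLike.inner_apply]

theorem norm_toLp_sq (hf : MemLp f 2 μ) : ‖hf.toLp f‖ ^ 2 = ∫ x, ‖f x‖ ^ 2 ∂μ := by
  have h := inner_toLp_toLp hf hf
  rw [inner_self_eq_norm_sq_to_K] at h
  simp_rw [Complex.mul_conj, Complex.normSq_eq_norm_sq] at h
  rw [integral_complex_ofReal] at h
  exact Complex.ofReal_injective (by simpa using h)

theorem norm_integral_mul_conj_sq_le (hf : MemLp f 2 μ) (hg : MemLp g 2 μ) :
    ‖∫ x, f x * (starRingEnd ℂ) (g x) ∂μ‖ ^ 2 ≤ (∫ x, ‖f x‖ ^ 2 ∂μ) * ∫ x, ‖g x‖ ^ 2 ∂μ := by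
  rw [← inner_toLp_toLp hf hg, ← norm_toLp_sq hf, ← norm_toLp_sq hg, ← mul_pow, mul_comm]
  gcongr
  exact norm_inner_le_norm _ _

end InnerToLp

/-! ### Existence of the kernel and its extremal bounds -/

section BergmanKernel

open InnerProductSpace

variable {n : ℕ} {Ω : Set (EuclideanSpace ℝ (Fin n))} {w : EuclideanSpace ℝ (Fin n) → ℝ}

/-- Evaluation at `y` of a harmonic function is its inner product with this function, if `Ω`
contains a ball about `y` of radius greater than `r`. -/
noncomputable def evaluationKernel (w : EuclideanSpace ℝ (Fin n) → ℝ) (r : ℝ)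
    (y x : EuclideanSpace ℝ (Fin n)) : ℂ :=
  ((meanKernel r (y - x) / w x : ℝ) : ℂ)

theorem meanKernel_sub_eq_zero_of_notMem {r R : ℝ} (hr : 0 < r) (hrR : r < R)
    {y x : EuclideanSpace ℝ (Fin n)} (hx : x ∉ Metric.ball y R) : meanKernel r (y - x) = 0 := by
  refine meanKernel_eq_zero hr ?_
  rw [Metric.mem_ball, dist_comm, dist_eq_norm, not_lt] at hx
  linarith

/-- Dividing the mean kernel by `w` cancels the weight, leaving the mean value property. -/
theorem integral_mul_conj_evaluationKernel (hΩ : IsOpen Ω) (hw : ContinuousOn w Ω)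
    (hpos : ∀ x ∈ Ω, 0 < w x) {r R : ℝ} (hr : 0 < r) (hrR : r < R)
    {y : EuclideanSpace ℝ (Fin n)} (hy : Metric.ball y R ⊆ Ω)
    {h : EuclideanSpace ℝ (Fin n) → ℂ} (hh : HarmonicOnNhd h Ω) :
    ∫ x, h x * (starRingEnd ℂ) (evaluationKernel w r y x) ∂(weightedMeasure Ω w) = h y := by
  rw [integral_weightedMeasure hΩ hw hpos, ← (hh.mono hy).integral_meanKernel_smul hr hrR]
  have h1 : ∀ x ∉ Ω, meanKernel r (y - x) • h x = 0 := fun x hx ↦ by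
    rw [meanKernel_sub_eq_zero_of_notMem hr hrR fun h ↦ hx (hy h), zero_smul]
  rw [← setIntegral_eq_integral_of_forall_compl_eq_zero h1]
  refine setIntegral_congr_fun hΩ.measurableSet fun x hx ↦ ?_
  have := (hpos x hx).ne'
  simp only [evaluationKernel, Complex.conj_ofReal, Complex.real_smul]
  push_cast
  have : (w x : ℂ) ≠ 0 := mod_cast this
  field_simp

theorem evaluationKernel_norm_sq_smul {x : EuclideanSpace ℝ (Fin n)} (hx : 0 < w x) (r : ℝ)
    (y : EuclideanSpace ℝ (Fin n)) :
    w x • ‖evaluationKernel w r y x‖ ^ 2 = (w x)⁻¹ * meanKernel r (y - x) ^ 2 := by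
  simp only [evaluationKernel, Complex.norm_real, Real.norm_eq_abs, sq_abs, smul_eq_mul]
  field_simp

theorem memLp_evaluationKernel (hΩ : IsOpen Ω) (hw : ContinuousOn w Ω)
    (hpos : ∀ x ∈ Ω, 0 < w x) {r R : ℝ} (hr : 0 < r) (hrR : r < R)
    {y : EuclideanSpace ℝ (Fin n)} (hy : Metric.ball y R ⊆ Ω) :
    MemLp (evaluationKernel w r y) 2 (weightedMeasure Ω w) := by
  have hm : Continuous (fun x ↦ meanKernel r (y - x)) :=
    (contDiff_meanKernel (m := 0) r).continuous.comp (by fun_prop)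
  have hc : ContinuousOn (evaluationKernel w r y) Ω :=
    Complex.continuous_ofReal.comp_continuousOn
      (hm.continuousOn.div hw fun x hx ↦ (hpos x hx).ne')
  rw [memLp_two_iff_integrable_sq_norm (aestronglyMeasurable_weightedMeasure hΩ hc),
    integrable_weightedMeasure_iff hΩ hw hpos]
  have hS : Metric.closedBall y r ⊆ Ω := (Metric.closedBall_subset_ball hrR).trans hy
  have h1 : IntegrableOn (fun x ↦ w x • ‖evaluationKernel w r y x‖ ^ 2) (Metric.closedBall y r) :=
    ((hw.mono hS).smul ((hc.mono hS).norm.pow 2)).integrableOn_compact (isCompact_closedBall y r)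
  refine h1.of_forall_sdiff_eq_zero hΩ.measurableSet fun x hx ↦ ?_
  rw [evaluationKernel_norm_sq_smul (hpos x hx.1), meanKernel_eq_zero hr]
  · simp
  · have := hx.2
    rw [Metric.mem_closedBall, dist_comm, dist_eq_norm, not_le] at this
    exact this.le

theorem integral_norm_evaluationKernel_sq_le (hΩ : IsOpen Ω) (hw : ContinuousOn w Ω)
    (hpos : ∀ x ∈ Ω, 0 < w x) {r R : ℝ} (hr : 0 < r) (hrR : r < R)
    {y : EuclideanSpace ℝ (Fin n)} (hy : Metric.ball y R ⊆ Ω) {c : ℝ} (hc : 0 < c)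
    (hcw : ∀ x ∈ Metric.ball y R, c ≤ w x) :
    ∫ x, ‖evaluationKernel w r y x‖ ^ 2 ∂(weightedMeasure Ω w) ≤
      c⁻¹ * ∫ x : EuclideanSpace ℝ (Fin n), meanKernel r (y - x) ^ 2 := by
  have hi : Integrable fun x ↦ meanKernel r (y - x) ^ 2 := by
    have hm : Continuous (meanKernel r : EuclideanSpace ℝ (Fin n) → ℝ) :=
      (contDiff_meanKernel (m := 0) r).continuous
    have hs : HasCompactSupport fun x : EuclideanSpace ℝ (Fin n) ↦ meanKernel r x ^ 2 :=
      (hasCompactSupport_meanKernel hr).comp_left (g := fun t : ℝ ↦ t ^ 2) (by simp)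
    exact ((hm.pow 2).integrable_of_hasCompactSupport hs).comp_sub_left y
  rw [integral_weightedMeasure hΩ hw hpos, ← integral_const_mul]
  have hk := (memLp_two_iff_integrable_sq_norm
    (memLp_evaluationKernel hΩ hw hpos hr hrR hy).1).1 (memLp_evaluationKernel hΩ hw hpos hr hrR hy)
  rw [integrable_weightedMeasure_iff hΩ hw hpos] at hk
  refine (setIntegral_mono_on hk (hi.const_mul c⁻¹).integrableOn hΩ.measurableSet
    fun x hx ↦ ?_).trans (setIntegral_le_integral (hi.const_mul c⁻¹)
      (.of_forall fun x ↦ by positivity))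
  rw [evaluationKernel_norm_sq_smul (hpos x hx)]
  by_cases hxb : x ∈ Metric.ball y R
  · gcongr
    exact hcw x hxb
  · simp [meanKernel_sub_eq_zero_of_notMem hr hrR hxb]

/-- The weighted harmonic Bergman space as a subspace of `L²`. -/
noncomputable def harmonicBergmanSubmodule (Ω : Set (EuclideanSpace ℝ (Fin n)))
    (w : EuclideanSpace ℝ (Fin n) → ℝ) : Submodule ℂ (Lp ℂ 2 (weightedMeasure Ω w)) where
  carrier := {f | ∃ h ∈ harmonicBergmanSpace Ω w, h =ᵐ[weightedMeasure Ω w] f}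
  add_mem' := by
    rintro f g ⟨h, hh, hf⟩ ⟨k, hk, hg⟩
    exact ⟨h + k, ⟨hh.1.add hk.1, hh.2.add hk.2⟩, (hf.add hg).trans (Lp.coeFn_add f g).symm⟩
  zero_mem' := ⟨fun _ ↦ 0, ⟨harmonicOnNhd_const 0, MemLp.zero⟩, (Lp.coeFn_zero _ _ _).symm⟩
  smul_mem' := by
    rintro c f ⟨h, hh, hf⟩
    refine ⟨c • h, ⟨?_, hh.2.const_smul c⟩, (hf.const_smul c).trans (Lp.coeFn_smul c f).symm⟩
    exact hh.1.comp_CLM (ContinuousLinearMap.mul ℝ ℂ c)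

theorem mem_harmonicBergmanSubmodule {f : Lp ℂ 2 (weightedMeasure Ω w)} :
    f ∈ harmonicBergmanSubmodule Ω w ↔
      ∃ h ∈ harmonicBergmanSpace Ω w, h =ᵐ[weightedMeasure Ω w] f := Iff.rfl

/-- Convergence in weighted `L²` implies `L¹` convergence on compact sets, hence a harmonic
pointwise limit. A subsequence converging almost everywhere identifies it with the `L²` limit. -/
theorem isClosed_harmonicBergmanSubmodule (hΩ : IsOpen Ω) (hw : ContinuousOn w Ω)
    (hpos : ∀ x ∈ Ω, 0 < w x) :
    IsClosed (harmonicBergmanSubmodule Ω w : Set (Lp ℂ 2 (weightedMeasure Ω w))) := by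
  refine IsSeqClosed.isClosed fun F f hF hlim ↦ ?_
  choose u hu huF using hF
  rw [Lp.tendsto_Lp_iff_tendsto_eLpNorm'] at hlim
  have hlim' : Tendsto (fun k ↦ eLpNorm (u k - (f : EuclideanSpace ℝ (Fin n) → ℂ)) 2
      (weightedMeasure Ω w)) atTop (𝓝 0) :=
    hlim.congr fun k ↦ eLpNorm_congr_ae ((huF k).symm.sub .rfl)
  have hac {S} (hS : S ⊆ Ω) (hSc : IsCompact S) : volume.restrict S ≪ weightedMeasure Ω w := by
    obtain ⟨C, hC, hle⟩ := exists_restrict_le_smul_weightedMeasure hw hpos hSc hS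
    exact Measure.absolutelyContinuous_of_le_smul hle
  have hfm {S} (hS : S ⊆ Ω) (hSc : IsCompact S) : AEStronglyMeasurable f (volume.restrict S) :=
    (Lp.aestronglyMeasurable f).mono_ac (hac hS hSc)
  have hum {S} (hS : S ⊆ Ω) (hSc : IsCompact S) (k) :
      AEStronglyMeasurable (u k) (volume.restrict S) :=
    (hu k).2.1.mono_ac (hac hS hSc)
  obtain ⟨g, hg, hgl⟩ := exists_harmonicOnNhd_tendsto_of_locally_tendsto_eLpNorm hΩ (u := u) (f := f)
    (fun k ↦ (hu k).1) (fun S hS hSc ↦ by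
      obtain ⟨C, hC, hle⟩ := exists_eLpNorm_one_restrict_le hw hpos hSc hS
      exact memLp_one_iff_integrable.1 ⟨hfm hS hSc, (hle f (hfm hS hSc)).trans_lt
        (ENNReal.mul_lt_top hC.lt_top (Lp.memLp f).2)⟩) (fun S hS hSc ↦ by
      obtain ⟨C, hC, hle⟩ := exists_eLpNorm_one_restrict_le hw hpos hSc hS
      refine tendsto_of_tendsto_of_tendsto_of_le_of_le tendsto_const_nhds ?_ (fun _ ↦ zero_le)
        fun k ↦ hle _ ((hum hS hSc k).sub (hfm hS hSc))
      simpa using ENNReal.Tendsto.const_mul hlim' (.inr hC))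
  obtain ⟨ns, hns, hae⟩ := (tendstoInMeasure_of_tendsto_eLpNorm (by norm_num)
    (fun k ↦ (hu k).2.1) (Lp.aestronglyMeasurable f) hlim').exists_seq_tendsto_ae
  have hgf : g =ᵐ[weightedMeasure Ω w] f := by
    have hΩae : ∀ᵐ x ∂(weightedMeasure Ω w), x ∈ Ω :=
      weightedMeasure_absolutelyContinuous.ae_le (ae_restrict_mem hΩ.measurableSet)
    filter_upwards [hae, hΩae] with x hx hxΩ
    exact tendsto_nhds_unique ((hgl x hxΩ).comp hns.tendsto_atTop) hx
  exact ⟨g, ⟨hg, (memLp_congr_ae hgf).2 (Lp.memLp f)⟩, hgf⟩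

/-- The evaluation kernel represents evaluation but need not be harmonic; its orthogonal projection
onto the closed harmonic subspace is the reproducing kernel. -/
theorem exists_isHarmonicBergmanKernel (hΩ : IsOpen Ω) (hw : ContinuousOn w Ω)
    (hpos : ∀ x ∈ Ω, 0 < w x) :
    ∃ R : EuclideanSpace ℝ (Fin n) → EuclideanSpace ℝ (Fin n) → ℂ,
      IsHarmonicBergmanKernel Ω w R := by
  have : CompleteSpace (harmonicBergmanSubmodule Ω w) :=
    (isClosed_harmonicBergmanSubmodule hΩ hw hpos).completeSpace_coe
  have key : ∀ y ∈ Ω, ∃ g ∈ harmonicBergmanSpace Ω w, ∀ h ∈ harmonicBergmanSpace Ω w,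
      h y = ∫ x, h x * (starRingEnd ℂ) (g x) ∂(weightedMeasure Ω w) := by
    intro y hy
    obtain ⟨R, hR, hRΩ⟩ := Metric.mem_nhds_iff.1 (hΩ.mem_nhds hy)
    have hk := memLp_evaluationKernel hΩ hw hpos (half_pos hR) (half_lt_self hR) hRΩ
    set V := harmonicBergmanSubmodule Ω w
    obtain ⟨g, hg, hgp⟩ := mem_harmonicBergmanSubmodule.1
      (V.starProjection_apply_mem (hk.toLp _))
    refine ⟨g, hg, fun h hh ↦ ?_⟩
    have hhV : hh.2.toLp h ∈ V := ⟨h, hh, hh.2.coeFn_toLp.symm⟩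
    have hgL : hg.2.toLp g = V.starProjection (hk.toLp _) :=
      Lp.ext (hg.2.coeFn_toLp.trans hgp)
    rw [← inner_toLp_toLp hh.2 hg.2, hgL, Submodule.inner_starProjection_left_eq_right,
      Submodule.starProjection_eq_self_iff.2 hhV, inner_toLp_toLp hh.2 hk,
      integral_mul_conj_evaluationKernel hΩ hw hpos (half_pos hR) (half_lt_self hR) hRΩ hh.1]
  choose! g hg hgr using key
  exact ⟨fun x y ↦ g y x, fun y hy ↦ ⟨hg y hy, hgr y hy⟩⟩

namespace IsHarmonicBergmanKernel

variable {R : EuclideanSpace ℝ (Fin n) → EuclideanSpace ℝ (Fin n) → ℂ}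
  {y : EuclideanSpace ℝ (Fin n)}

theorem re_self (hR : IsHarmonicBergmanKernel Ω w R) (hy : y ∈ Ω) :
    (R y y).re = ∫ x, ‖R x y‖ ^ 2 ∂(weightedMeasure Ω w) := by
  have h := (hR y hy).2 _ (hR y hy).1
  simp_rw [Complex.mul_conj, Complex.normSq_eq_norm_sq] at h
  rw [integral_complex_ofReal] at h
  rw [h]
  exact Complex.ofReal_re _

theorem re_self_nonneg (hR : IsHarmonicBergmanKernel Ω w R) (hy : y ∈ Ω) : 0 ≤ (R y y).re := by
  rw [hR.re_self hy]
  positivity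

theorem norm_sq_le (hR : IsHarmonicBergmanKernel Ω w R) (hy : y ∈ Ω)
    {h : EuclideanSpace ℝ (Fin n) → ℂ} (hh : h ∈ harmonicBergmanSpace Ω w) :
    ‖h y‖ ^ 2 ≤ (∫ x, ‖h x‖ ^ 2 ∂(weightedMeasure Ω w)) * (R y y).re := by
  rw [hR.re_self hy, (hR y hy).2 h hh]
  exact norm_integral_mul_conj_sq_le hh.2 (hR y hy).1.2

theorem re_self_le (hR : IsHarmonicBergmanKernel Ω w R) (hΩ : IsOpen Ω) (hw : ContinuousOn w Ω)
    (hpos : ∀ x ∈ Ω, 0 < w x) {r s : ℝ} (hr : 0 < r) (hrs : r < s)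
    (hy : Metric.ball y s ⊆ Ω) {c : ℝ} (hc : 0 < c) (hcw : ∀ x ∈ Metric.ball y s, c ≤ w x) :
    (R y y).re ≤ c⁻¹ * ∫ x : EuclideanSpace ℝ (Fin n), meanKernel r (y - x) ^ 2 := by
  have hyΩ : y ∈ Ω := hy (Metric.mem_ball_self (hr.trans hrs))
  refine le_trans ?_ (integral_norm_evaluationKernel_sq_le hΩ hw hpos hr hrs hy hc hcw)
  have h1 := norm_integral_mul_conj_sq_le (hR y hyΩ).1.2
    (memLp_evaluationKernel hΩ hw hpos hr hrs hy)
  rw [integral_mul_conj_evaluationKernel hΩ hw hpos hr hrs hy (hR y hyΩ).1.1,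
    ← hR.re_self hyΩ] at h1
  have h2 : (R y y).re ^ 2 ≤ ‖R y y‖ ^ 2 := by
    rw [sq_le_sq, abs_norm]
    exact Complex.abs_re_le_norm _
  rcases (hR.re_self_nonneg hyΩ).eq_or_lt with h0 | h0
  · rw [← h0]
    positivity
  · exact le_of_mul_le_mul_left (by nlinarith) h0

end IsHarmonicBergmanKernel

end BergmanKernel

/-! ### Supporting hyperplanes of convex functions -/

section Subgradient

/-- Separate the graph point from the interior of the epigraph. The vertical component `c` of the
functional is nonpositive because the epigraph is unbounded upwards. If it were zero, the horizontal
part would have a local maximum at `x`, forcing the whole functional to vanish. Dividing by `-c`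
gives the subgradient. -/
theorem ConvexOn.exists_subgradient {E : Type*} [NormedAddCommGroup E] [NormedSpace ℝ E]
    {s : Set E} {φ : E → ℝ} {x : E} (hφ : ConvexOn ℝ s φ) (hs : s ∈ 𝓝 x)
    (hc : ContinuousAt φ x) :
    ∃ g : StrongDual ℝ E, ∀ y ∈ s, φ x + g (y - x) ≤ φ y := by
  set A := {p : E × ℝ | p.1 ∈ s ∧ φ p.1 ≤ p.2}
  have hxs : x ∈ s := mem_of_mem_nhds hs
  have hint : (x, φ x + 1) ∈ interior A := by
    rw [mem_interior_iff_mem_nhds]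
    have h1 : ∀ᶠ p : E × ℝ in 𝓝 (x, φ x + 1), p.1 ∈ s := continuousAt_fst.eventually hs
    have h2 : ∀ᶠ p : E × ℝ in 𝓝 (x, φ x + 1), φ p.1 < p.2 :=
      (ContinuousAt.comp (f := Prod.fst) (g := φ) (x := (x, φ x + 1)) hc
        continuousAt_fst).eventually_lt continuousAt_snd (by simp)
    filter_upwards [h1, h2] with p hp1 hp2 using ⟨hp1, hp2.le⟩
  have hnot : (x, φ x) ∉ interior A := by
    intro h
    rw [mem_interior_iff_mem_nhds] at h
    have hcont : ContinuousAt (fun t : ℝ ↦ (x, t)) (φ x) := by fun_prop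
    have h3 : ∀ᶠ t in 𝓝 (φ x), φ x ≤ t := (hcont.eventually h).mono fun t ht ↦ ht.2
    obtain ⟨t, ht, ht'⟩ :=
      ((h3.filter_mono nhdsWithin_le_nhds).and (self_mem_nhdsWithin (s := Set.Iio (φ x)))).exists
    exact absurd ht (not_le.2 ht')
  obtain ⟨f, hf0, hf⟩ := geometric_hahn_banach_of_nonempty_interior_point hφ.convex_epigraph
    hnot ⟨_, hint⟩
  set g : StrongDual ℝ E := f.comp (.inl ℝ E ℝ)
  set c : ℝ := f (0, 1)
  have hfd (y : E) (t : ℝ) : f (y, t) = g y + t * c := by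
    have : (y, t) = (y, 0) + t • ((0, 1) : E × ℝ) := by simp
    rw [this, map_add, map_smul]
    simp [g, c]
  have hle (y : E) (hy : y ∈ s) (t : ℝ) (ht : φ y ≤ t) : g y + t * c ≤ g x + φ x * c := by
    rw [← hfd, ← hfd]
    exact hf _ ⟨hy, ht⟩
  have hc0 : c ≤ 0 := by
    have := hle x hxs (φ x + 1) (by linarith)
    linarith
  have hcne : c ≠ 0 := by
    intro h0
    have hmax : IsLocalMax g x := by
      filter_upwards [hs] with y hy
      simpa [h0] using hle y hy _ le_rfl
    have hg0 : g = 0 := by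
      rw [← g.fderiv (x := x)]
      exact hmax.fderiv_eq_zero
    refine hf0 (ContinuousLinearMap.ext fun p ↦ ?_)
    rw [← Prod.mk.eta (p := p), hfd, h0, hg0]
    simp
  have hcneg : c < 0 := lt_of_le_of_ne hc0 hcne
  refine ⟨(-c)⁻¹ • g, fun y hy ↦ ?_⟩
  have h := hle y hy _ le_rfl
  have hcp : 0 < -c := by linarith
  simp only [smul_apply, smul_eq_mul, map_sub]
  rw [← le_sub_iff_add_le', ← mul_sub, inv_mul_le_iff₀ hcp]
  nlinarith

end Subgradient

/-! ### Harmonic exponentials with prescribed modulus -/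

section ExponentialHarmonic

open InnerProductSpace

variable {E : Type*} [NormedAddCommGroup E] [InnerProductSpace ℝ E]

theorem exists_orthogonal_norm_eq (hE : 2 ≤ Module.finrank ℝ E) (ξ : E) :
    ∃ η : E, inner ℝ ξ η = 0 ∧ ‖η‖ = ‖ξ‖ := by
  have hbot : (ℝ ∙ ξ)ᗮ ≠ ⊥ := by
    intro h
    rw [Submodule.orthogonal_eq_bot_iff] at h
    have h1 : Module.finrank ℝ (ℝ ∙ ξ) ≤ 1 := finrank_span_le_card ({ξ} : Set E)
    rw [h, finrank_top] at h1
    omega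
  obtain ⟨v, hv, hv0⟩ := Submodule.exists_mem_ne_zero_of_ne_bot hbot
  refine ⟨(‖ξ‖ / ‖v‖) • v, ?_, ?_⟩
  · rw [inner_smul_right, Submodule.mem_orthogonal_singleton_iff_inner_right.1 hv, mul_zero]
  · rw [norm_smul, Real.norm_of_nonneg (by positivity), div_mul_cancel₀ _ (norm_ne_zero_iff.2 hv0)]

variable [FiniteDimensional ℝ E]

/-- The Laplacian multiplies the exponential by the sum of the `L (b i) ^ 2`. -/
theorem harmonicAt_cexp_clm {ι : Type*} [Fintype ι] (b : OrthonormalBasis ι ℝ E)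
    (L : E →L[ℝ] ℂ) (hL : ∑ i, L (b i) ^ 2 = 0) (x₀ x : E) :
    HarmonicAt (fun z ↦ Complex.exp (L (z - x₀))) x := by
  have hd : ContDiff ℝ 2 fun z ↦ Complex.exp (L (z - x₀)) :=
    (L.contDiff.comp (contDiff_id.sub contDiff_const)).cexp
  have hin (z : E) : HasFDerivAt (fun z ↦ L (z - x₀)) L z :=
    L.hasFDerivAt.comp z ((hasFDerivAt_id z).sub_const x₀)
  have h1 (v : E) : (fun z ↦ fderiv ℝ (fun z ↦ Complex.exp (L (z - x₀))) z v) =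
      fun z ↦ L v * Complex.exp (L (z - x₀)) := by
    ext z
    rw [(hin z).cexp.fderiv]
    simp [mul_comm]
  refine ⟨hd.contDiffAt, .of_forall fun z ↦ ?_⟩
  rw [laplacian_eq_sum_fderiv_fderiv b hd.contDiffAt]
  have h2 (i) : fderiv ℝ (fun z ↦ fderiv ℝ (fun z ↦ Complex.exp (L (z - x₀))) z (b i)) z (b i) =
      L (b i) ^ 2 * Complex.exp (L (z - x₀)) := by
    rw [h1, ((hin z).cexp.const_mul _).fderiv]
    simp
    ring
  simp_rw [h2, ← Finset.sum_mul, hL]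
  simp

/-- Every exponential of a real linear functional is the modulus of a harmonic function. -/
theorem exists_harmonicOnNhd_norm_eq_exp (hE : 2 ≤ Module.finrank ℝ E) (g : StrongDual ℝ E)
    (x₀ : E) (s : Set E) :
    ∃ h : E → ℂ, HarmonicOnNhd h s ∧ ∀ z, ‖h z‖ = Real.exp (g (z - x₀)) := by
  obtain ⟨η, hη, hn⟩ := exists_orthogonal_norm_eq hE ((InnerProductSpace.toDual ℝ E).symm g)
  set ξ := (InnerProductSpace.toDual ℝ E).symm g
  -- With `η` orthogonal to `ξ` and of equal length, `ξ + iη` is isotropic: `‖ξ‖² - ‖η‖² + 2i⟨ξ, η⟩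
  -- = 0`. The term in `η` only changes the phase of the exponential.
  let L : E →L[ℝ] ℂ := Complex.ofRealCLM.comp (innerSL ℝ ξ) +
    Complex.I • Complex.ofRealCLM.comp (innerSL ℝ η)
  have hL (v : E) : L v = (inner ℝ ξ v : ℝ) + Complex.I * (inner ℝ η v : ℝ) := by simp [L]
  let b := stdOrthonormalBasis ℝ E
  have hsum : ∑ i, L (b i) ^ 2 = 0 := by
    have h1 := b.sum_inner_mul_inner ξ ξ
    have h2 := b.sum_inner_mul_inner η η
    have h3 := b.sum_inner_mul_inner ξ η
    simp_rw [real_inner_comm _ (b _)] at h1 h2 h3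
    have h4 (i) : L (b i) ^ 2 = ((inner ℝ ξ (b i) * inner ℝ ξ (b i) -
        inner ℝ η (b i) * inner ℝ η (b i) : ℝ) : ℂ) +
        2 * Complex.I * ((inner ℝ ξ (b i) * inner ℝ η (b i) : ℝ) : ℂ) := by
      rw [hL]
      push_cast
      linear_combination (inner ℝ η (b i) : ℂ) ^ 2 * Complex.I_sq
    simp_rw [h4]
    rw [Finset.sum_add_distrib, ← Finset.mul_sum, ← Complex.ofReal_sum, ← Complex.ofReal_sum,
      Finset.sum_sub_distrib, h1, h2, h3, hη]
    simp [hn]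
  refine ⟨fun z ↦ Complex.exp (L (z - x₀)), fun x _ ↦ harmonicAt_cexp_clm b L hsum x₀ x,
    fun z ↦ ?_⟩
  rw [Complex.norm_exp, hL]
  simp [ξ]

end ExponentialHarmonic

/-! ### The two bounds and the limit -/

section Asymptotics

variable {n : ℕ} {Ω : Set (EuclideanSpace ℝ (Fin n))} {ρ : EuclideanSpace ℝ (Fin n) → ℝ}

theorem exists_le_mul_exp_of_convexOn_log_inv (hΩ : IsOpen Ω) (hρ : ContinuousOn ρ Ω)
    (hpos : ∀ x ∈ Ω, 0 < ρ x) {φ : EuclideanSpace ℝ (Fin n) → ℝ}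
    (hφ : ConvexOn ℝ (convexHull ℝ Ω) φ) (hφρ : ∀ x ∈ Ω, φ x = Real.log (1 / ρ x))
    {x : EuclideanSpace ℝ (Fin n)} (hx : x ∈ Ω) :
    ∃ g : StrongDual ℝ (EuclideanSpace ℝ (Fin n)),
      ∀ y ∈ Ω, ρ y * Real.exp (g (y - x)) ≤ ρ x := by
  have hc : ContinuousAt φ x := by
    have h1 : ContinuousAt (fun z ↦ Real.log (1 / ρ z)) x :=
      (continuousAt_const.div (hρ.continuousAt (hΩ.mem_nhds hx)) (hpos x hx).ne').log
        (one_div_pos.2 (hpos x hx)).ne'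
    refine h1.congr ?_
    filter_upwards [hΩ.mem_nhds hx] with z hz using (hφρ z hz).symm
  obtain ⟨g, hg⟩ := hφ.exists_subgradient
    (mem_of_superset (hΩ.mem_nhds hx) (subset_convexHull ℝ Ω)) hc
  refine ⟨g, fun y hy ↦ ?_⟩
  have h := hg y (subset_convexHull ℝ Ω hy)
  rw [hφρ x hx, hφρ y hy, one_div, one_div, Real.log_inv, Real.log_inv] at h
  rw [← Real.exp_log (hpos y hy), ← Real.exp_add]
  calc _ ≤ Real.exp (Real.log (ρ x)) := Real.exp_le_exp.2 (by linarith)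
    _ = ρ x := Real.exp_log (hpos x hx)

theorem IsHarmonicBergmanKernel.one_le_mul_re_self (hn : 2 ≤ n) (hΩ : IsOpen Ω)
    (hbdd : Bornology.IsBounded Ω) (hρ : ContinuousOn ρ Ω) (hpos : ∀ x ∈ Ω, 0 < ρ x)
    {x : EuclideanSpace ℝ (Fin n)} (hx : x ∈ Ω)
    {g : StrongDual ℝ (EuclideanSpace ℝ (Fin n))}
    (hg : ∀ y ∈ Ω, ρ y * Real.exp (g (y - x)) ≤ ρ x) {α : ℝ} (hα : 0 < α)
    {R : EuclideanSpace ℝ (Fin n) → EuclideanSpace ℝ (Fin n) → ℂ}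
    (hR : IsHarmonicBergmanKernel Ω (fun x ↦ ρ x ^ α) R) :
    1 ≤ volume.real Ω * ρ x ^ α * (R x x).re := by
  have hw : ContinuousOn (fun x ↦ ρ x ^ α) Ω := hρ.rpow_const fun x hx ↦ .inl (hpos x hx).ne'
  have hwpos : ∀ x ∈ Ω, 0 < ρ x ^ α := fun x hx ↦ Real.rpow_pos_of_pos (hpos x hx) α
  -- The factor `α / 2` makes `‖h‖ ^ 2` the `α`-th power of `exp (g (y - x))`, matching the weight
  -- `ρ ^ α`.
  obtain ⟨h, hh, hnorm⟩ := exists_harmonicOnNhd_norm_eq_exp (by simpa using hn)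
    ((α / 2) • g) x Ω
  have hle : ∀ y ∈ Ω, ρ y ^ α • ‖h y‖ ^ 2 ≤ ρ x ^ α := by
    intro y hy
    refine le_trans (le_of_eq ?_) (Real.rpow_le_rpow (by have := hpos y hy; positivity)
      (hg y hy) hα.le)
    rw [hnorm, Real.mul_rpow (hpos y hy).le (Real.exp_pos _).le, ← Real.exp_mul,
      ← Real.exp_nat_mul, smul_eq_mul]
    simp only [smul_apply, smul_eq_mul]
    congr 2
    push_cast
    ring
  have hvol : volume Ω ≠ ⊤ := hbdd.measure_lt_top.ne
  have hconst : IntegrableOn (fun _ : EuclideanSpace ℝ (Fin n) ↦ ρ x ^ α) Ω :=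
    integrableOn_const hvol
  have hint : IntegrableOn (fun y ↦ ρ y ^ α • ‖h y‖ ^ 2) Ω := by
    refine hconst.mono' ((hw.smul (hh.continuousOn.norm.pow 2)).aestronglyMeasurable
      hΩ.measurableSet) ?_
    filter_upwards [ae_restrict_mem hΩ.measurableSet] with y hy
    rw [Real.norm_of_nonneg (smul_nonneg (hwpos y hy).le (by positivity))]
    exact hle y hy
  have hmem : MemLp h 2 (weightedMeasure Ω fun x ↦ ρ x ^ α) :=
    (memLp_two_iff_integrable_sq_norm
      (aestronglyMeasurable_weightedMeasure hΩ hh.continuousOn)).2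
      ((integrable_weightedMeasure_iff hΩ hw hwpos).2 hint)
  have h1 := hR.norm_sq_le hx ⟨hh, hmem⟩
  have h2 : ∫ y, ‖h y‖ ^ 2 ∂(weightedMeasure Ω fun x ↦ ρ x ^ α) ≤ volume.real Ω * ρ x ^ α := by
    rw [integral_weightedMeasure hΩ hw hwpos]
    refine (setIntegral_mono_on hint hconst hΩ.measurableSet hle).trans_eq ?_
    simp
  have h3 : ‖h x‖ = 1 := by simp [hnorm]
  rw [h3, one_pow] at h1
  exact h1.trans (mul_le_mul_of_nonneg_right h2 (hR.re_self_nonneg hx))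

theorem tendsto_rpow_one_div_atTop {c : ℝ} (hc : 0 < c) :
    Tendsto (fun α : ℝ ↦ c ^ (1 / α)) atTop (𝓝 1) := by
  have h : Tendsto (fun α : ℝ ↦ 1 / α) atTop (𝓝 0) := by
    simpa using tendsto_inv_atTop_zero (𝕜 := ℝ)
  simpa using tendsto_const_nhds.rpow h (.inl hc.ne')

theorem tendsto_re_harmonicBergmanKernel_rpow (hn : 2 ≤ n) (hΩ : IsOpen Ω)
    (hbdd : Bornology.IsBounded Ω) (hρ : ContinuousOn ρ Ω) (hpos : ∀ x ∈ Ω, 0 < ρ x)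
    {φ : EuclideanSpace ℝ (Fin n) → ℝ} (hφ : ConvexOn ℝ (convexHull ℝ Ω) φ)
    (hφρ : ∀ x ∈ Ω, φ x = Real.log (1 / ρ x))
    {R : ℝ → EuclideanSpace ℝ (Fin n) → EuclideanSpace ℝ (Fin n) → ℂ}
    (hR : ∀ᶠ α in atTop, IsHarmonicBergmanKernel Ω (fun x ↦ ρ x ^ α) (R α))
    {x : EuclideanSpace ℝ (Fin n)} (hx : x ∈ Ω) :
    Tendsto (fun α : ℝ ↦ (R α x x).re ^ (1 / α)) atTop (𝓝 (1 / ρ x)) := by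
  have hρx := hpos x hx
  have hroot {a α : ℝ} (ha : 0 < a) (hα : 0 < α) : (a ^ α) ^ (1 / α) = a := by
    rw [← Real.rpow_mul ha.le, mul_one_div_cancel hα.ne', Real.rpow_one]
  rw [tendsto_order]
  constructor
  · intro a ha
    obtain ⟨g, hg⟩ := exists_le_mul_exp_of_convexOn_log_inv hΩ hρ hpos hφ hφρ hx
    have hV : 0 < volume.real Ω :=
      ENNReal.toReal_pos (hΩ.measure_pos volume ⟨x, hx⟩).ne' hbdd.measure_lt_top.ne
    have hlim := (tendsto_rpow_one_div_atTop (inv_pos.2 hV)).mul_const (1 / ρ x)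
    rw [one_mul] at hlim
    filter_upwards [hlim.eventually_const_lt ha, hR, eventually_gt_atTop 0] with α h1 h2 hα
    refine h1.trans_le ?_
    have h3 := h2.one_le_mul_re_self hn hΩ hbdd hρ hpos hx hg hα
    have hp : 0 < ρ x ^ α := Real.rpow_pos_of_pos hρx α
    have h4 : (volume.real Ω)⁻¹ * (1 / ρ x) ^ α ≤ (R α x x).re := by
      rw [Real.div_rpow zero_le_one hρx.le, Real.one_rpow, inv_mul_le_iff₀ hV, div_le_iff₀ hp]
      linarith
    calc (volume.real Ω)⁻¹ ^ (1 / α) * (1 / ρ x)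
        = ((volume.real Ω)⁻¹ * (1 / ρ x) ^ α) ^ (1 / α) := by
          rw [Real.mul_rpow (by positivity) (by positivity), hroot (by positivity) hα]
      _ ≤ _ := Real.rpow_le_rpow (by positivity) h4 (by positivity)
  · intro a ha
    -- The intermediate `b` fixes one ball on which `ρ > b⁻¹`, so the constant `C` below is the same
    -- for all `α`.
    obtain ⟨b, hb1, hb2⟩ := exists_between ha
    have hb : 0 < b := (one_div_pos.2 hρx).trans hb1
    have hlt : b⁻¹ < ρ x := by
      rw [inv_lt_comm₀ hb hρx]
      simpa using hb1
    have hnhds : ∀ᶠ z in 𝓝 x, z ∈ Ω ∧ b⁻¹ < ρ z :=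
      (hΩ.eventually_mem hx).and ((hρ.continuousAt (hΩ.mem_nhds hx)).eventually_const_lt hlt)
    obtain ⟨s, hs, hsb⟩ := Metric.eventually_nhds_iff_ball.1 hnhds
    set C := ∫ z : EuclideanSpace ℝ (Fin n), meanKernel (s / 2) (x - z) ^ 2
    have hC : 0 ≤ C := integral_nonneg fun z ↦ sq_nonneg _
    -- Using `C + 1` guarantees a positive base, whose `α`-th root tends to one, without proving `C
    -- ≠ 0`.
    have hlim := (tendsto_rpow_one_div_atTop (show 0 < C + 1 by linarith)).mul_const b
    rw [one_mul] at hlim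
    filter_upwards [hlim.eventually_lt_const hb2, hR, eventually_gt_atTop 0] with α h1 h2 hα
    refine lt_of_le_of_lt ?_ h1
    have hw : ContinuousOn (fun x ↦ ρ x ^ α) Ω := hρ.rpow_const fun x hx ↦ .inl (hpos x hx).ne'
    have h3 := h2.re_self_le hΩ hw (fun z hz ↦ Real.rpow_pos_of_pos (hpos z hz) α) (half_pos hs)
      (half_lt_self hs) (fun z hz ↦ (hsb z hz).1) (c := b⁻¹ ^ α) (by positivity)
      fun z hz ↦ Real.rpow_le_rpow (by positivity) (hsb z hz).2.le hα.le
    have h4 : (R α x x).re ≤ (C + 1) * b ^ α := by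
      refine h3.trans ?_
      rw [Real.inv_rpow hb.le, inv_inv, mul_comm]
      gcongr
      linarith
    calc (R α x x).re ^ (1 / α) ≤ ((C + 1) * b ^ α) ^ (1 / α) :=
          Real.rpow_le_rpow (h2.re_self_nonneg hx) h4 (by positivity)
      _ = _ := by rw [Real.mul_rpow (by positivity) (by positivity), hroot hb hα]

end Asymptotics

theorem theorem1 (n : ℕ) (hn : 2 ≤ n) (Ω : Set (EuclideanSpace ℝ (Fin n)))
    (hΩ_open : IsOpen Ω) (hΩ_conn : IsConnected Ω) (hΩ_bdd : Bornology.IsBounded Ω)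
    (ρ : EuclideanSpace ℝ (Fin n) → ℝ)
    (hρ_cont : ContinuousOn ρ Ω) (hρ_pos : ∀ x ∈ Ω, 0 < ρ x)
    (hρ_bdd : ∃ M : ℝ, ∀ x ∈ Ω, ρ x ≤ M)
    (hρ_convex : ∃ φ : EuclideanSpace ℝ (Fin n) → ℝ,
      ConvexOn ℝ (convexHull ℝ Ω) φ ∧ ∀ x ∈ Ω, φ x = Real.log (1 / ρ x)) :
    (∀ α : ℝ, 0 < α →
      ∃ R : EuclideanSpace ℝ (Fin n) → EuclideanSpace ℝ (Fin n) → ℂ,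
        IsHarmonicBergmanKernel Ω (fun x => ρ x ^ α) R) ∧
    ∀ R : ℝ → EuclideanSpace ℝ (Fin n) → EuclideanSpace ℝ (Fin n) → ℂ,
      (∀ᶠ α in atTop, IsHarmonicBergmanKernel Ω (fun x => ρ x ^ α) (R α)) →
      ∀ x ∈ Ω, Tendsto (fun α : ℝ => (R α x x).re ^ (1 / α)) atTop (𝓝 (1 / ρ x)) := by
  obtain ⟨φ, hφ, hφρ⟩ := hρ_convex
  refine ⟨fun α _ ↦ exists_isHarmonicBergmanKernel hΩ_open
    (hρ_cont.rpow_const fun x hx ↦ .inl (hρ_pos x hx).ne')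
    fun x hx ↦ Real.rpow_pos_of_pos (hρ_pos x hx) α, fun R hR x hx ↦ ?_⟩
  exact tendsto_re_harmonicBergmanKernel_rpow hn hΩ_open hΩ_bdd hρ_cont hρ_pos hφ hφρ hR hx
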